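/- A special commutative Frobenius structure on an object $X$ of a symmetric monoidal category $(\mathcal H,\otimes,I)$ consists of maps $\mu:X\otimes X\to X$, $\eta:I\to X$, $\delta:X\to X\otimes X$, $\epsilon:X\to I$ such that $(\mu,\eta)$ is a commutative monoid, $(\delta,\epsilon)$ is a cocommutative comonoid, the Frobenius law holds (the maps $(\mathrm{id}_X\otimes\mu)\circ(\delta\otimes \mathrm{id}_X)$, $\delta\circ\mu$ and $(\mu\otimes \mathrm{id}_X)\circ(\mathrm{id}_X\otimes\delta)$ agree, up to associators) and $\mu\circ\delta=\mathrm{id}_X$. A hypergraph category is a (small) symmetric monoidal category $\mathcal H$ with a chosen such structure $(\mu_X,\eta_X,\delta_X,\epsilon_X)$ on every object $X$, such that the structure on $X\otimes Y$ is the tensor product of those on $X$ and $Y$ (formed with the symmetry), and $\eta_I=\mathrm{id}_I=\epsilon_I$. A hypergraph functor is a strong symmetric monoidal functor $(F,\varphi)$ that preserves the chosen structures, i.e. the structure on $FX$ is the image of the one on $X$ under $F$ and $\varphi$. Let $\mathbf{Hyp}$ be the 2-category of hypergraph categories, hypergraph functors and monoidal natural transformations; two hypergraph categories are hypergraph equivalent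 if they are equivalent in this 2-category. An objectwise-free hypergraph category is a triple $(\mathcal H,\Lambda,i)$ of a strict hypergraph category $\mathcal H$ (one whose underlying monoidal category is strict), a set $\Lambda$, and a monoid isomorphism $i:\mathrm{List}(\Lambda)\cong\mathrm{Ob}(\mathcal H)$, where lists form a monoid under concatenation and objects under $\otimes$. Let $\mathbf{Hyp}_{\mathrm{OF}}$ be the 2-category whose objects are the objectwise-free hypergraph categories and whose 1- and 2-morphisms are those between the underlying hypergraph categories. Theorem. The forgetful 2-functor $U:\mathbf{Hyp}_{\mathrm{OF}}\to\mathbf{Hyp}$ is a 2-equivalence: there is a pseudofunctor $G:\mathbf{Hyp}\to\mathbf{Hyp}_{\mathrm{OF}}$ such that $G\circ U$ and $U\circ G$ are pseudonaturally equivalent to the identities. In particular $U$ is essentially surjective, i.e. every hypergraph category is hypergraph equivalent to an objectwise-free one. More precisely, for every hypergraph category $\mathcal H$ there are a hypergraph category $\mathcal K$ that is objectwise-free on the set $\Lambda=\mathrm{Ob}(\mathcal H)$, via some $i$, and mutually inverse hypergraph equivalences $P:\mathcal K\to\mathcal H$ and $S:\mathcal H\to\mathcal K$ such that $P(i[x_1,\dots,x_m])=((\cdots(x_1\otimes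 x_2)\otimes\cdots)\otimes x_m)\otimes I$ for every nonempty list, $P(i[\,])=I$, and $S(x)=i[x]$ for every object $x$ of $\mathcal H$. -/

import Mathlib

open CategoryTheory MonoidalCategory

universe v u

namespace HypergraphCat

/-- A special commutative Frobenius monoid structure `(μ, η, δ, ε)` on an object `X` of a symmetric
monoidal category: a monoid object and a comonoid object (with `mul = μ`, `one = η`,
`comul = δ`, `counit = ε`) that are commutative resp. cocommutative and satisfy the Frobenius law
and the special law. -/
structure FrobeniusStructure {C : Type u} [Category.{v} C] [MonoidalCategory C]
    [SymmetricCategory C] (X : C) extends MonObj X, ComonObj X where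
  mul_comm : (β_ X X).hom ≫ mul = mul
  comul_comm : comul ≫ (β_ X X).hom = comul
  frobenius_left : comul ▷ X ≫ (α_ X X X).hom ≫ X ◁ mul = mul ≫ comul
  frobenius_right : X ◁ comul ≫ (α_ X X X).inv ≫ mul ▷ X = mul ≫ comul
  special : comul ≫ mul = 𝟙 X

/-- A hypergraph category: a symmetric monoidal category with a chosen Frobenius structure on every
object, compatible with the monoidal product and satisfying the unit coherence axiom
`η_I = 𝟙_I = ε_I`. Here `tensorμ A B C D` is the canonical "middle four interchange"
`(A ⊗ B) ⊗ (C ⊗ D) ⟶ (A ⊗ C) ⊗ (B ⊗ D)` built from associators and one braiding. -/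
class HypergraphCategory (C : Type u) [Category.{v} C] [MonoidalCategory C]
    [SymmetricCategory C] where
  frob (X : C) : FrobeniusStructure X
  mul_tensor (X Y : C) :
    (frob (X ⊗ Y)).mul = tensorμ X Y X Y ≫ ((frob X).mul ⊗ₘ (frob Y).mul)
  one_tensor (X Y : C) :
    (frob (X ⊗ Y)).one = (λ_ (𝟙_ C)).inv ≫ ((frob X).one ⊗ₘ (frob Y).one)
  comul_tensor (X Y : C) :
    (frob (X ⊗ Y)).comul = ((frob X).comul ⊗ₘ (frob Y).comul) ≫ tensorμ X X Y Y
  counit_tensor (X Y : C) :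
    (frob (X ⊗ Y)).counit = ((frob X).counit ⊗ₘ (frob Y).counit) ≫ (λ_ (𝟙_ C)).hom
  one_unit : (frob (𝟙_ C)).one = 𝟙 (𝟙_ C)
  counit_unit : (frob (𝟙_ C)).counit = 𝟙 (𝟙_ C)


section Functors

variable {C D : Type u} [Category.{v} C] [MonoidalCategory C] [SymmetricCategory C]
  [HypergraphCategory C] [Category.{v} D] [MonoidalCategory D] [SymmetricCategory D]
  [HypergraphCategory D]

/-- A strong symmetric monoidal functor preserves hypergraph structures if the chosen Frobenius
structure on `F.obj X` is the image of the chosen Frobenius structure on `X`. -/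
class PreservesFrobenius (F : C ⥤ D) [F.Braided] : Prop where
  mul (X : C) : (HypergraphCategory.frob (F.obj X)).mul =
    Functor.LaxMonoidal.μ F X X ≫ F.map (HypergraphCategory.frob X).mul
  one (X : C) : (HypergraphCategory.frob (F.obj X)).one =
    Functor.LaxMonoidal.ε F ≫ F.map (HypergraphCategory.frob X).one
  comul (X : C) : (HypergraphCategory.frob (F.obj X)).comul =
    F.map (HypergraphCategory.frob X).comul ≫ Functor.OplaxMonoidal.δ F X X
  counit (X : C) : (HypergraphCategory.frob (F.obj X)).counit =
    F.map (HypergraphCategory.frob X).counit ≫ Functor.OplaxMonoidal.η F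

end Functors

/-- A (bundled) hypergraph category. -/
structure Hyp : Type (max (u + 1) (v + 1)) where
  carrier : Type u
  [category : Category.{v} carrier]
  [monoidal : MonoidalCategory carrier]
  [symmetric : SymmetricCategory carrier]
  [hypergraph : HypergraphCategory carrier]

namespace Hyp

instance : CoeSort Hyp.{v, u} (Type u) := ⟨carrier⟩

attribute [instance] category monoidal symmetric hypergraph

/-- A hypergraph functor: a strong symmetric monoidal functor that preserves the Frobenius
structures. -/
structure Hom (H K : Hyp.{v, u}) where
  functor : H ⥤ K
  [braided : functor.Braided]
  [preserves : PreservesFrobenius functor]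

attribute [instance] Hom.braided Hom.preserves

/-- A 2-morphism of hypergraph functors: a monoidal natural transformation. -/
@[ext]
structure Hom₂ {H K : Hyp.{v, u}} (F G : Hom H K) where
  nat : F.functor ⟶ G.functor
  [isMonoidal : NatTrans.IsMonoidal nat]

attribute [instance] Hom₂.isMonoidal

instance preservesFrobenius_id (H : Hyp.{v, u}) : PreservesFrobenius (𝟭 H) where
  mul X := by simp
  one X := by simp
  comul X := by simp
  counit X := by simp

instance preservesFrobenius_comp {H K L : Hyp.{v, u}} (F : Hom H K) (G : Hom K L) :
    PreservesFrobenius (F.functor ⋙ G.functor) where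
  mul X := by
    simp [PreservesFrobenius.mul]
  one X := by
    simp [PreservesFrobenius.one]
  comul X := by
    simp [PreservesFrobenius.comul]
  counit X := by
    simp [PreservesFrobenius.counit]

instance categoryStruct : CategoryStruct Hyp.{v, u} where
  Hom := Hom
  id H := { functor := 𝟭 H }
  comp F G := { functor := F.functor ⋙ G.functor }

instance homCategory (H K : Hyp.{v, u}) : Category (H ⟶ K) where
  Hom F G := Hom₂ F G
  id F := { nat := 𝟙 F.functor }
  comp a b := { nat := a.nat ≫ b.nat }

@[ext]
theorem hom₂_ext {H K : Hyp.{v, u}} {F G : H ⟶ K} {a b : F ⟶ G} (h : a.nat = b.nat) : a = b :=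
  Hom₂.ext h

@[simp]
theorem id_nat {H K : Hyp.{v, u}} (F : H ⟶ K) : Hom₂.nat (𝟙 F) = 𝟙 F.functor := rfl

@[simp]
theorem comp_nat {H K : Hyp.{v, u}} {F G L : H ⟶ K} (a : F ⟶ G) (b : G ⟶ L) :
    Hom₂.nat (a ≫ b) = a.nat ≫ b.nat := rfl

/-- A monoidal natural isomorphism is an invertible 2-morphism. -/
def isoMk {H K : Hyp.{v, u}} {F G : H ⟶ K} (e : F.functor ≅ G.functor)
    [hm : NatTrans.IsMonoidal e.hom] : F ≅ G where
  hom := { nat := e.hom }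
  inv := { nat := e.inv }
  hom_inv_id := by ext1; exact e.hom_inv_id
  inv_hom_id := by ext1; exact e.inv_hom_id

/-- The 2-category of hypergraph categories, hypergraph functors and monoidal natural
transformations. -/
instance bicategory : Bicategory Hyp.{v, u} where
  homCategory := homCategory
  whiskerLeft F _ _ a := Hom₂.mk (Functor.whiskerLeft F.functor a.nat)
  whiskerRight a F := Hom₂.mk (Functor.whiskerRight a.nat F.functor)
  associator F G H := isoMk (F := (F ≫ G) ≫ H) (G := F ≫ G ≫ H)
    (Functor.associator F.functor G.functor H.functor)
    (hm := inferInstanceAs (NatTrans.IsMonoidal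
      (Functor.associator F.functor G.functor H.functor).hom))
  leftUnitor {H _} F := isoMk (F := 𝟙 H ≫ F) (G := F) F.functor.leftUnitor
    (hm := inferInstanceAs (NatTrans.IsMonoidal F.functor.leftUnitor.hom))
  rightUnitor {_ K} F := isoMk (F := F ≫ 𝟙 K) (G := F) F.functor.rightUnitor
    (hm := inferInstanceAs (NatTrans.IsMonoidal F.functor.rightUnitor.hom))
  whiskerLeft_id F G := hom₂_ext (Functor.whiskerLeft_id' F.functor)
  whiskerLeft_comp F _ _ _ a b := hom₂_ext (Functor.whiskerLeft_comp F.functor a.nat b.nat)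
  id_whiskerLeft a :=
    hom₂_ext (by ext X; exact ((Category.id_comp _).trans (Category.comp_id _)).symm)
  comp_whiskerLeft F G _ _ a :=
    hom₂_ext (by ext X; exact ((Category.id_comp _).trans (Category.comp_id _)).symm)
  id_whiskerRight F G := hom₂_ext (Functor.whiskerRight_id' G.functor)
  comp_whiskerRight a b G := hom₂_ext (Functor.whiskerRight_comp a.nat b.nat G.functor)
  whiskerRight_id a :=
    hom₂_ext (by ext X; exact ((Category.id_comp _).trans (Category.comp_id _)).symm)
  whiskerRight_comp a F G :=
    hom₂_ext (by ext X; exact ((Category.id_comp _).trans (Category.comp_id _)).symm)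
  whisker_assoc F _ _ a G :=
    hom₂_ext (by ext X; exact ((Category.id_comp _).trans (Category.comp_id _)).symm)
  whisker_exchange a b :=
    hom₂_ext (by ext X; exact (b.nat.naturality _).symm)
  pentagon F G H K := hom₂_ext (Functor.pentagon F.functor G.functor H.functor K.functor)
  triangle F G := hom₂_ext (Functor.triangle F.functor G.functor)

theorem hom_ext {H K : Hyp.{v, u}} {F G : H ⟶ K} (h : F.functor = G.functor)
    (h' : HEq F.braided G.braided) : F = G := by
  obtain ⟨F⟩ := F
  obtain ⟨G⟩ := G
  obtain rfl : F = G := h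
  obtain rfl := eq_of_heq h'
  rfl

theorem braided_ext {C D : Type u} [Category.{v} C] [MonoidalCategory C] [SymmetricCategory C]
    [Category.{v} D] [MonoidalCategory D] [SymmetricCategory D] {F : C ⥤ D}
    (a b : F.Braided) (h : a.ε = b.ε) (h' : a.μ = b.μ) : a = b := by
  have hL : a.toLaxMonoidal = b.toLaxMonoidal := Functor.LaxMonoidal.ext h h'
  have hM : a.toMonoidal = b.toMonoidal := Functor.Monoidal.toLaxMonoidal_injective F hL
  cases a
  cases b
  cases hM
  rfl

theorem eqToHom_nat {H K : Hyp.{v, u}} {F G : H ⟶ K} (h : F = G) :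
    Hom₂.nat (eqToHom h) = eqToHom (congrArg Hom.functor h) := by
  subst h
  rfl

instance strict : Bicategory.Strict Hyp.{v, u} where
  id_comp F := hom_ext (Functor.id_comp F.functor) (heq_of_eq (braided_ext _ _
    ((congrArg _ (F.functor.map_id _)).trans (Category.comp_id _))
    (by
      funext X Y
      exact (congrArg _ (F.functor.map_id _)).trans (Category.comp_id _))))
  comp_id F := hom_ext (Functor.comp_id F.functor) (heq_of_eq (braided_ext _ _
    (Category.id_comp _)
    (by
      funext X Y
      exact Category.id_comp _)))
  assoc F G H := hom_ext (Functor.assoc F.functor G.functor H.functor) (heq_of_eq (braided_ext _ _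
    (by
      change _ ≫ H.functor.map (_ ≫ G.functor.map _) = (_ ≫ H.functor.map _) ≫ _
      rw [Functor.map_comp, Category.assoc]
      rfl)
    (by
      funext X Y
      change _ ≫ H.functor.map (_ ≫ G.functor.map _) = (_ ≫ H.functor.map _) ≫ _
      rw [Functor.map_comp, Category.assoc]
      rfl)))
  leftUnitor_eqToIso F := by
    ext : 2
    simp only [eqToIso.hom, eqToHom_nat]
    rfl
  rightUnitor_eqToIso F := by
    ext : 2
    simp only [eqToIso.hom, eqToHom_nat]
    rfl
  associator_eqToIso F G H := by
    ext : 2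
    simp only [eqToIso.hom, eqToHom_nat]
    rfl

end Hyp

/-- A strict monoidal category: the monoidal product is strictly associative and unital on objects
and the associators and unitors are identities (transported along these equalities). -/
class IsStrictMonoidal (C : Type u) [Category.{v} C] [MonoidalCategory C] : Prop where
  tensor_assoc (X Y Z : C) : (X ⊗ Y) ⊗ Z = X ⊗ (Y ⊗ Z)
  unit_tensor (X : C) : 𝟙_ C ⊗ X = X
  tensor_unit (X : C) : X ⊗ 𝟙_ C = X
  associator_hom (X Y Z : C) : (α_ X Y Z).hom = eqToHom (tensor_assoc X Y Z)
  leftUnitor_hom (X : C) : (λ_ X).hom = eqToHom (unit_tensor X)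
  rightUnitor_hom (X : C) : (ρ_ X).hom = eqToHom (tensor_unit X)

/-- An objectwise-free structure on `Λ` on a monoidal category `C`: the category is strict monoidal,
and there is a monoid isomorphism `List(Λ) ≅ Ob(C)` from lists under concatenation to objects
under the monoidal product. -/
structure ObjectwiseFree (Λ : Type u) (C : Type u) [Category.{v} C] [MonoidalCategory C] where
  strict : IsStrictMonoidal C
  equiv : List Λ ≃ C
  equiv_nil : equiv [] = 𝟙_ C
  equiv_append (x y : List Λ) : equiv (x ++ y) = equiv x ⊗ equiv y

/-- An objectwise-free hypergraph category `(H, Λ, i)`. -/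
structure OFHypergraphCategory : Type (max (u + 1) (v + 1)) where
  toHyp : Hyp.{v, u}
  gen : Type u
  free : ObjectwiseFree gen toHyp

/-- The full sub-2-category on objectwise-free hypergraph categories: 1-morphisms and
2-morphisms are those of the underlying hypergraph categories. -/
abbrev HypOF : Type (max (u + 1) (v + 1)) :=
  Bicategory.InducedBicategory Hyp.{v, u} OFHypergraphCategory.toHyp

/-- The forgetful (strict) 2-functor from objectwise-free hypergraph categories to hypergraph
categories. -/
def forgetOF : StrictPseudofunctor HypOF.{v, u} Hyp.{v, u} :=
  Bicategory.InducedBicategory.forget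

open scoped CategoryTheory.Pseudofunctor.StrongTrans in
/-- A pseudofunctor `F : B → C` is a 2-equivalence if it has a pseudoinverse: a pseudofunctor
`G : C → B` such that `F ⋙ G` and `G ⋙ F` are equivalent to the identities in the bicategories of
pseudofunctors, strong (pseudonatural) transformations and modifications. -/
def Is2Equivalence {B C : Type*} [Bicategory B] [Bicategory C] (F : Pseudofunctor B C) : Prop :=
  ∃ G : Pseudofunctor C B,
    Nonempty (Bicategory.Equivalence (F.comp G) (Pseudofunctor.id B)) ∧
      Nonempty (Bicategory.Equivalence (G.comp F) (Pseudofunctor.id C))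

/-- The pre-parenthesized product of a list of objects, with all parentheses at the front:
`[x₁, …, xₘ] ↦ ((x₁ ⊗ x₂) ⊗ ⋯ ⊗ xₘ) ⊗ I`, and `[] ↦ I`. -/
def listTensor {C : Type u} [Category.{v} C] [MonoidalCategory C] : List C → C
  | [] => 𝟙_ C
  | x :: xs => xs.foldl (fun a b => a ⊗ b) x ⊗ 𝟙_ C

end HypergraphCat

open HypergraphCat

/-! The whole theorem reduces to a choice, for each hypergraph category `H`, of an objectwise-free
`K H` and an equivalence `e H : K H ≃ H` in `Hyp`. Since `HypOF` has the 1- and 2-cells of `Hyp`,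
such a choice yields a pseudoinverse by conjugation: `f` is sent to `(e H).hom ≫ f ≫ (e H').inv`.
The functors `(e H).hom` and `(e H).inv` are then the components of pseudonatural transformations
between either composite and the identity, with modifications given by the units and counits
(`forgetOF_is2Equivalence`). Structural 2-cells of `Hyp` have identity components, so every law
becomes an equation of morphisms in one category, settled by naturality, cancellation and the
triangle identities.

The equivalence is strictification. Objects are lists of objects of `H`, and morphisms are those of
`H` between the products of the lists, so that realization is fully faithful and the monoidal
structure, braiding and Frobenius structures are all pulled back along it. An arbitrary isomorphism
need not respect the chosen Frobenius structures; the pullback is compatible with `⊗` because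
unitors and associators do respect them (`IsFrobeniusHom`), hence so do the coherence maps of
realization. The same fact transports preservation to the prescribed parenthesization `listTensor`,
and, through the counit `ρ`, to the inverse functor sending `X` to `[X]`. -/

namespace HypergraphCat

/-! ### A pseudoinverse from pointwise equivalences: components of 2-cells. -/

section PseudoInverse

open Bicategory

namespace Hyp

section Components

variable {H K L M : Hyp.{v, u}}

@[simp]
theorem id_functor : Hom.functor (𝟙 H) = 𝟭 H := rfl

@[simp]
theorem comp_functor (F : H ⟶ K) (G : K ⟶ L) : Hom.functor (F ≫ G) = F.functor ⋙ G.functor := rfl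

@[simp]
theorem whiskerLeft_nat (F : H ⟶ K) {G G' : K ⟶ L} (a : G ⟶ G') :
    Hom₂.nat (F ◁ a) = Functor.whiskerLeft F.functor a.nat := rfl

@[simp]
theorem whiskerRight_nat {F F' : H ⟶ K} (a : F ⟶ F') (G : K ⟶ L) :
    Hom₂.nat (a ▷ G) = Functor.whiskerRight a.nat G.functor := rfl

@[simp]
theorem associator_hom_nat_app (F : H ⟶ K) (G : K ⟶ L) (T : L ⟶ M) (X : H) :
    (Hom₂.nat (α_ F G T).hom).app X = 𝟙 _ := rfl

@[simp]
theorem associator_inv_nat_app (F : H ⟶ K) (G : K ⟶ L) (T : L ⟶ M) (X : H) :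
    (Hom₂.nat (α_ F G T).inv).app X = 𝟙 _ := rfl

@[simp]
theorem leftUnitor_hom_nat_app (F : H ⟶ K) (X : H) :
    (Hom₂.nat (Bicategory.leftUnitor F).hom).app X = 𝟙 _ := rfl

@[simp]
theorem leftUnitor_inv_nat_app (F : H ⟶ K) (X : H) :
    (Hom₂.nat (Bicategory.leftUnitor F).inv).app X = 𝟙 _ := rfl

@[simp]
theorem rightUnitor_hom_nat_app (F : H ⟶ K) (X : H) :
    (Hom₂.nat (Bicategory.rightUnitor F).hom).app X = 𝟙 _ := rfl

@[simp]
theorem rightUnitor_inv_nat_app (F : H ⟶ K) (X : H) :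
    (Hom₂.nat (Bicategory.rightUnitor F).inv).app X = 𝟙 _ := rfl

@[simp]
theorem hom_inv_nat_app {F G : H ⟶ K} (e : F ≅ G) (X : H) :
    (Hom₂.nat e.hom).app X ≫ (Hom₂.nat e.inv).app X = 𝟙 _ := by
  rw [← NatTrans.comp_app, ← comp_nat, e.hom_inv_id]
  rfl

@[simp]
theorem inv_hom_nat_app {F G : H ⟶ K} (e : F ≅ G) (X : H) :
    (Hom₂.nat e.inv).app X ≫ (Hom₂.nat e.hom).app X = 𝟙 _ :=
  hom_inv_nat_app e.symm X

@[simp]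
theorem hom_inv_nat_app_assoc {F G : H ⟶ K} (e : F ≅ G) (X : H) {Z : K}
    (h : F.functor.obj X ⟶ Z) :
    (Hom₂.nat e.hom).app X ≫ (Hom₂.nat e.inv).app X ≫ h = h := by
  rw [← Category.assoc, hom_inv_nat_app, Category.id_comp]

@[simp]
theorem inv_hom_nat_app_assoc {F G : H ⟶ K} (e : F ≅ G) (X : H) {Z : K}
    (h : G.functor.obj X ⟶ Z) :
    (Hom₂.nat e.inv).app X ≫ (Hom₂.nat e.hom).app X ≫ h = h :=
  hom_inv_nat_app_assoc e.symm X h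

theorem hom₂_ext_app {F G : H ⟶ K} {a b : F ⟶ G} (h : ∀ X, a.nat.app X = b.nat.app X) : a = b :=
  hom₂_ext (NatTrans.ext (funext h))

/-- Evaluating the bicategorical zigzag at an object removes all associators and unitors, leaving
the usual triangle identity. -/
theorem left_triangle_app (e : Bicategory.Equivalence H K) (X : H) :
    e.hom.functor.map ((Hom₂.nat e.unit.hom).app X) ≫
      (Hom₂.nat e.counit.hom).app (e.hom.functor.obj X) = 𝟙 _ := by
  have h := congrArg (fun t => (Hom₂.nat t).app X) e.left_triangle_hom
  simpa [leftZigzag, bicategoricalComp, BicategoricalCoherence.assoc,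
    BicategoricalCoherence.iso] using h

theorem right_triangle_app (e : Bicategory.Equivalence H K) (X : K) :
    (Hom₂.nat e.unit.hom).app (e.inv.functor.obj X) ≫
      e.inv.functor.map ((Hom₂.nat e.counit.hom).app X) = 𝟙 _ := by
  have h := congrArg (fun t => (Hom₂.nat t).app X) e.right_triangle_hom
  simpa [rightZigzag, bicategoricalComp, BicategoricalCoherence.assoc,
    BicategoricalCoherence.iso] using h

theorem left_triangle_inv_app (e : Bicategory.Equivalence H K) (X : H) :
    (Hom₂.nat e.counit.inv).app (e.hom.functor.obj X) ≫
      e.hom.functor.map ((Hom₂.nat e.unit.inv).app X) = 𝟙 _ := by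
  have h := left_triangle_app e X
  calc _ = (Hom₂.nat e.counit.inv).app (e.hom.functor.obj X) ≫
      e.hom.functor.map ((Hom₂.nat e.unit.inv).app X) ≫
      e.hom.functor.map ((Hom₂.nat e.unit.hom).app X) ≫
      (Hom₂.nat e.counit.hom).app (e.hom.functor.obj X) := by
        rw [h, Category.comp_id]
    _ = 𝟙 _ := by
        rw [← Functor.map_comp_assoc, inv_hom_nat_app]
        simp

theorem right_triangle_inv_app (e : Bicategory.Equivalence H K) (X : K) :
    e.inv.functor.map ((Hom₂.nat e.counit.inv).app X) ≫
      (Hom₂.nat e.unit.inv).app (e.inv.functor.obj X) = 𝟙 _ := by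
  have h := right_triangle_app e X
  calc _ = e.inv.functor.map ((Hom₂.nat e.counit.inv).app X) ≫
      (Hom₂.nat e.unit.inv).app (e.inv.functor.obj X) ≫
      (Hom₂.nat e.unit.hom).app (e.inv.functor.obj X) ≫
      e.inv.functor.map ((Hom₂.nat e.counit.hom).app X) := by
        rw [h, Category.comp_id]
    _ = 𝟙 _ := by
        rw [inv_hom_nat_app_assoc, ← Functor.map_comp, inv_hom_nat_app]
        simp

@[simp]
theorem counit_naturality (e : Bicategory.Equivalence H K) {X Y : K} (f : X ⟶ Y) :
    e.hom.functor.map (e.inv.functor.map f) ≫ (Hom₂.nat e.counit.hom).app Y =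
      (Hom₂.nat e.counit.hom).app X ≫ f :=
  (Hom₂.nat e.counit.hom).naturality f

@[simp]
theorem counit_naturality_assoc (e : Bicategory.Equivalence H K) {X Y Z : K} (f : X ⟶ Y)
    (g : Y ⟶ Z) :
    e.hom.functor.map (e.inv.functor.map f) ≫ (Hom₂.nat e.counit.hom).app Y ≫ g =
      (Hom₂.nat e.counit.hom).app X ≫ f ≫ g := by
  rw [← Category.assoc, counit_naturality, Category.assoc]

@[simp]
theorem counit_inv_naturality (e : Bicategory.Equivalence H K) {X Y : K} (f : X ⟶ Y) :
    (Hom₂.nat e.counit.inv).app X ≫ e.hom.functor.map (e.inv.functor.map f) =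
      f ≫ (Hom₂.nat e.counit.inv).app Y :=
  ((Hom₂.nat e.counit.inv).naturality f).symm

theorem counit_hom_app_hom_obj (e : Bicategory.Equivalence H K) (X : H) :
    (Hom₂.nat e.counit.hom).app (e.hom.functor.obj X) =
      e.hom.functor.map ((Hom₂.nat e.unit.inv).app X) := by
  rw [← hom_inv_nat_app_assoc e.counit (e.hom.functor.obj X)
    (e.hom.functor.map ((Hom₂.nat e.unit.inv).app X)), left_triangle_inv_app, Category.comp_id]

theorem counit_inv_app_hom_obj (e : Bicategory.Equivalence H K) (X : H) :
    (Hom₂.nat e.counit.inv).app (e.hom.functor.obj X) =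
      e.hom.functor.map ((Hom₂.nat e.unit.hom).app X) := by
  have h := congrArg (· ≫ (Hom₂.nat e.counit.inv).app (e.hom.functor.obj X))
    (left_triangle_app e X)
  simpa using h.symm

end Components

end Hyp

/-! ### The pseudofunctor given by conjugation. -/

section Replacement

variable (K : Hyp.{v, u} → HypOF.{v, u})
  (e : ∀ H, Bicategory.Equivalence (forgetOF.obj (K H)) H)

/-- Conjugation of a hypergraph functor by chosen hypergraph equivalences. -/
abbrev conj {H H' : Hyp.{v, u}} (f : H ⟶ H') : forgetOF.obj (K H) ⟶ forgetOF.obj (K H') :=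
  (e H).hom ≫ f ≫ (e H').inv

/-- Conjugation preserves identities up to isomorphism. -/
def conjId (H : Hyp.{v, u}) : conj K e (𝟙 H) ≅ 𝟙 _ :=
  whiskerLeftIso (e H).hom (Bicategory.leftUnitor (e H).inv) ≪≫ (e H).unit.symm

/-- Conjugation preserves composition up to isomorphism. -/
def conjComp {H H' H'' : Hyp.{v, u}} (f : H ⟶ H') (g : H' ⟶ H'') :
    conj K e (f ≫ g) ≅ conj K e f ≫ conj K e g :=
  whiskerLeftIso (e H).hom (Bicategory.associator f g (e H'').inv ≪≫
    whiskerLeftIso f ((Bicategory.leftUnitor (g ≫ (e H'').inv)).symm ≪≫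
      whiskerRightIso (e H').counit.symm (g ≫ (e H'').inv) ≪≫
      Bicategory.associator _ _ _) ≪≫
    (Bicategory.associator _ _ _).symm) ≪≫ (Bicategory.associator _ _ _).symm

@[simp]
theorem conjId_hom_nat_app (H : Hyp.{v, u}) (X) :
    (Hyp.Hom₂.nat (conjId K e H).hom).app X = (Hyp.Hom₂.nat (e H).unit.inv).app X := by
  simp [conjId]

@[simp]
theorem conjComp_hom_nat_app {H H' H'' : Hyp.{v, u}} (f : H ⟶ H') (g : H' ⟶ H'') (X) :
    (Hyp.Hom₂.nat (conjComp K e f g).hom).app X = (e H'').inv.functor.map (g.functor.map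
      ((Hyp.Hom₂.nat (e H').counit.inv).app (f.functor.obj ((e H).hom.functor.obj X)))) := by
  simp [conjComp]

@[simp]
theorem conjComp_inv_nat_app {H H' H'' : Hyp.{v, u}} (f : H ⟶ H') (g : H' ⟶ H'') (X) :
    (Hyp.Hom₂.nat (conjComp K e f g).inv).app X = (e H'').inv.functor.map (g.functor.map
      ((Hyp.Hom₂.nat (e H').counit.hom).app (f.functor.obj ((e H).hom.functor.obj X)))) := by
  simp [conjComp]

/-- The action of conjugation on 2-morphisms. -/
abbrev conjMap₂ {H H' : Hyp.{v, u}} {f g : H ⟶ H'} (a : f ⟶ g) : conj K e f ⟶ conj K e g :=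
  (e H).hom ◁ a ▷ (e H').inv

theorem conjMap₂_whisker_left {H H' H'' : Hyp.{v, u}} (f : H ⟶ H') {g h : H' ⟶ H''} (a : g ⟶ h) :
    conjMap₂ K e (f ◁ a) =
      (conjComp K e f g).hom ≫ conj K e f ◁ conjMap₂ K e a ≫ (conjComp K e f h).inv :=
  Hyp.hom₂_ext_app fun X => by
    simp
    rw [← Functor.map_comp, ← Functor.map_comp, ← a.nat.naturality, ← Functor.map_comp_assoc,
      Hyp.inv_hom_nat_app]
    simp

theorem conjMap₂_whisker_right {H H' H'' : Hyp.{v, u}} {f g : H ⟶ H'} (a : f ⟶ g) (h : H' ⟶ H'') :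
    conjMap₂ K e (a ▷ h) =
      (conjComp K e f h).hom ≫ conjMap₂ K e a ▷ conj K e h ≫ (conjComp K e g h).inv :=
  Hyp.hom₂_ext_app fun X => by
    simp
    simp only [← Functor.map_comp, Hyp.counit_naturality, Hyp.inv_hom_nat_app_assoc]

/-- Coherence for composition needs only naturality of the counit and its invertibility; the
triangle identities enter with the unit laws. -/
theorem conjMap₂_associator {H₀ H₁ H₂ H₃ : Hyp.{v, u}} (f : H₀ ⟶ H₁) (g : H₁ ⟶ H₂)
    (h : H₂ ⟶ H₃) :
    conjMap₂ K e (Bicategory.associator f g h).hom =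
      (conjComp K e (f ≫ g) h).hom ≫ (conjComp K e f g).hom ▷ conj K e h ≫
        (Bicategory.associator (conj K e f) (conj K e g) (conj K e h)).hom ≫
          conj K e f ◁ (conjComp K e g h).inv ≫ (conjComp K e f (g ≫ h)).inv :=
  Hyp.hom₂_ext_app fun X => by
    simp
    simp only [← Functor.map_comp, Hyp.counit_naturality_assoc, Hyp.inv_hom_nat_app_assoc,
      Hyp.inv_hom_nat_app]
    simp

theorem conjMap₂_leftUnitor {H H' : Hyp.{v, u}} (f : H ⟶ H') :
    conjMap₂ K e (Bicategory.leftUnitor f).hom =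
      (conjComp K e (𝟙 H) f).hom ≫ (conjId K e H).hom ▷ conj K e f ≫
        (Bicategory.leftUnitor (conj K e f)).hom :=
  Hyp.hom₂_ext_app fun X => by
    simp
    simp only [← Functor.map_comp, Hyp.left_triangle_inv_app]
    simp

theorem conjMap₂_rightUnitor {H H' : Hyp.{v, u}} (f : H ⟶ H') :
    conjMap₂ K e (Bicategory.rightUnitor f).hom =
      (conjComp K e f (𝟙 H')).hom ≫ conj K e f ◁ (conjId K e H').hom ≫
        (Bicategory.rightUnitor (conj K e f)).hom :=
  Hyp.hom₂_ext_app fun X => by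
    simp
    exact (Hyp.right_triangle_inv_app _ _).symm

/-- The pseudofunctor replacing every hypergraph category by a chosen equivalent objectwise-free
one. -/
def replacement : Pseudofunctor Hyp.{v, u} HypOF.{v, u} where
  obj := K
  map f := InducedBicategory.mkHom (conj K e f)
  map₂ a := InducedBicategory.mkHom₂ (conjMap₂ K e a)
  mapId H := InducedBicategory.isoMk (conjId K e H)
  mapComp f g := InducedBicategory.isoMk (conjComp K e f g)
  map₂_id f := InducedBicategory.hom₂_ext (by dsimp only [conjMap₂]; simp; rfl)
  map₂_comp a b := InducedBicategory.hom₂_ext (by dsimp only [conjMap₂]; simp; rfl)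
  map₂_whisker_left f _ _ a := InducedBicategory.hom₂_ext (conjMap₂_whisker_left K e f a)
  map₂_whisker_right a f := InducedBicategory.hom₂_ext (conjMap₂_whisker_right K e a f)
  map₂_associator f g h := InducedBicategory.hom₂_ext (conjMap₂_associator K e f g h)
  map₂_left_unitor f := InducedBicategory.hom₂_ext (conjMap₂_leftUnitor K e f)
  map₂_right_unitor f := InducedBicategory.hom₂_ext (conjMap₂_rightUnitor K e f)

end Replacement

section Bicategory

variable {B : Type*} [Bicategory B] {a b c : B}

/-- Removes the structure 2-cell of an identity pseudofunctor from the axioms of a strong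
transformation; that 2-cell is an identity only by unfolding, hence the default `rfl`. -/
theorem comp_whiskerLeft_id {f : a ⟶ c} {g : a ⟶ b} {h : b ⟶ c} (s : f ⟶ g ≫ h) (t : h ⟶ h)
    (ht : t = 𝟙 h := by rfl) : s ≫ g ◁ t = s := by
  rw [ht, Bicategory.whiskerLeft_id, Category.comp_id]

theorem id_whiskerRight_comp {f : a ⟶ c} {g : a ⟶ b} {h : b ⟶ c} (s : g ≫ h ⟶ f) (t : g ⟶ g)
    (ht : t = 𝟙 g := by rfl) : t ▷ h ≫ s = s := by
  rw [ht, Bicategory.id_whiskerRight, Category.id_comp]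

end Bicategory

/-! ### Pseudonatural equivalences with the identities. -/

section Replacement

variable (K : Hyp.{v, u} → HypOF.{v, u})
  (e : ∀ H, Bicategory.Equivalence (forgetOF.obj (K H)) H)

/-- The chosen equivalences intertwine a hypergraph functor and its conjugate. -/
def conjHom {H H' : Hyp.{v, u}} (f : H ⟶ H') : conj K e f ≫ (e H').hom ≅ (e H).hom ≫ f :=
  Bicategory.associator _ _ _ ≪≫ whiskerLeftIso (e H).hom (Bicategory.associator _ _ _ ≪≫
    whiskerLeftIso f (e H').counit ≪≫ Bicategory.rightUnitor f)

/-- The chosen inverse equivalences intertwine a hypergraph functor and its conjugate. -/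
def conjInv {H H' : Hyp.{v, u}} (f : H ⟶ H') : f ≫ (e H').inv ≅ (e H).inv ≫ conj K e f :=
  (Bicategory.leftUnitor _).symm ≪≫ whiskerRightIso (e H).counit.symm _ ≪≫
    Bicategory.associator _ _ _

@[simp]
theorem conjHom_hom_nat_app {H H' : Hyp.{v, u}} (f : H ⟶ H') (X) :
    (Hyp.Hom₂.nat (conjHom K e f).hom).app X =
      (Hyp.Hom₂.nat (e H').counit.hom).app (f.functor.obj ((e H).hom.functor.obj X)) := by
  simp [conjHom]

@[simp]
theorem conjInv_hom_nat_app {H H' : Hyp.{v, u}} (f : H ⟶ H') (X) :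
    (Hyp.Hom₂.nat (conjInv K e f).hom).app X =
      (e H').inv.functor.map (f.functor.map ((Hyp.Hom₂.nat (e H).counit.inv).app X)) := by
  simp [conjInv]

theorem conjHom_naturality {H H' : Hyp.{v, u}} {f g : H ⟶ H'} (a : f ⟶ g) :
    conjMap₂ K e a ▷ (e H').hom ≫ (conjHom K e g).hom = (conjHom K e f).hom ≫ (e H).hom ◁ a :=
  Hyp.hom₂_ext_app fun X => by
    simp

theorem conjHom_id (H : Hyp.{v, u}) :
    (conjHom K e (𝟙 H)).hom = (conjId K e H).hom ▷ (e H).hom ≫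
      (Bicategory.leftUnitor (e H).hom).hom ≫ (Bicategory.rightUnitor (e H).hom).inv :=
  Hyp.hom₂_ext_app fun X => by
    simp
    exact Hyp.counit_hom_app_hom_obj _ _

theorem conjHom_comp {H H' H'' : Hyp.{v, u}} (f : H ⟶ H') (g : H' ⟶ H'') :
    (conjHom K e (f ≫ g)).hom =
      (conjComp K e f g).hom ▷ (e H'').hom ≫ (Bicategory.associator _ _ _).hom ≫
        conj K e f ◁ (conjHom K e g).hom ≫ (Bicategory.associator _ _ _).inv ≫
          (conjHom K e f).hom ▷ g ≫ (Bicategory.associator _ _ _).hom :=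
  Hyp.hom₂_ext_app fun X => by
    simp
    rw [← Functor.map_comp, Hyp.inv_hom_nat_app]
    simp

theorem conjInv_naturality {H H' : Hyp.{v, u}} {f g : H ⟶ H'} (a : f ⟶ g) :
    a ▷ (e H').inv ≫ (conjInv K e g).hom = (conjInv K e f).hom ≫ (e H).inv ◁ conjMap₂ K e a :=
  Hyp.hom₂_ext_app fun X => by
    simp
    simp only [← Functor.map_comp, a.nat.naturality]

theorem conjInv_id (H : Hyp.{v, u}) :
    (conjInv K e (𝟙 H)).hom ≫ (e H).inv ◁ (conjId K e H).hom =
      (Bicategory.leftUnitor (e H).inv).hom ≫ (Bicategory.rightUnitor (e H).inv).inv :=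
  Hyp.hom₂_ext_app fun X => by
    simp
    exact Hyp.right_triangle_inv_app _ _

theorem conjInv_comp {H H' H'' : Hyp.{v, u}} (f : H ⟶ H') (g : H' ⟶ H'') :
    (conjInv K e (f ≫ g)).hom ≫ (e H).inv ◁ (conjComp K e f g).hom =
      (Bicategory.associator _ _ _).hom ≫ f ◁ (conjInv K e g).hom ≫
        (Bicategory.associator _ _ _).inv ≫ (conjInv K e f).hom ▷ conj K e g ≫
          (Bicategory.associator _ _ _).hom :=
  Hyp.hom₂_ext_app fun X => by
    simp
    simp only [← Functor.map_comp, Hyp.counit_inv_naturality]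

/-- Both triangle identities are used: the right one for `e H'`, and the left one for `e H` to turn
the inverse counit on the image of `(e H).hom` into the unit. -/
theorem unit_modification {H H' : Hyp.{v, u}} (f : H ⟶ H') :
    conj K e f ◁ (e H').unit.hom ≫ (Bicategory.associator _ _ _).inv ≫
      (conjHom K e f).hom ▷ (e H').inv ≫ (Bicategory.associator _ _ _).hom ≫
        (e H).hom ◁ (conjInv K e f).hom ≫ (Bicategory.associator _ _ _).inv =
      ((Bicategory.rightUnitor _).hom ≫ (Bicategory.leftUnitor _).inv) ≫
        (e H).unit.hom ▷ conj K e f :=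
  Hyp.hom₂_ext_app fun X => by
    simp
    rw [← Category.assoc, Hyp.right_triangle_app, Hyp.counit_inv_app_hom_obj]
    simp

theorem counit_modification {H H' : Hyp.{v, u}} (f : H ⟶ H') :
    f ◁ (e H').counit.hom ≫ (Bicategory.rightUnitor _).hom ≫ (Bicategory.leftUnitor _).inv =
      ((Bicategory.associator _ _ _).inv ≫
      (conjInv K e f).hom ▷ (e H').hom ≫ (Bicategory.associator _ _ _).hom ≫
        (e H).inv ◁ (conjHom K e f).hom ≫ (Bicategory.associator _ _ _).inv) ≫
        (e H).counit.hom ▷ f :=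
  Hyp.hom₂_ext_app fun X => by
    simp
    rw [← Functor.map_comp, Hyp.inv_hom_nat_app]
    simp

/-- The forgetful 2-functor, as a pseudofunctor. -/
abbrev forgetPseudo : Pseudofunctor HypOF.{v, u} Hyp.{v, u} := forgetOF.toPseudofunctor

theorem replacement_comp_mapId (H : Hyp.{v, u}) :
    ((replacement K e).comp forgetPseudo).mapId H = conjId K e H :=
  Iso.ext (Category.comp_id _)

theorem replacement_comp_mapComp {H H' H'' : Hyp.{v, u}} (f : H ⟶ H') (g : H' ⟶ H'') :
    ((replacement K e).comp forgetPseudo).mapComp f g = conjComp K e f g :=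
  Iso.ext (Category.comp_id _)

theorem comp_replacement_mapId (A : HypOF.{v, u}) :
    (forgetPseudo.comp (replacement K e)).mapId A =
      InducedBicategory.isoMk (conjId K e (forgetOF.obj A)) := by
  refine Iso.ext ?_
  -- The forgetful 2-functor is strict, so its own structure cell is an identity, carried to an
  -- identity by `replacement`.
  change (replacement K e).map₂ (𝟙 _) ≫ _ = _
  rw [PrelaxFunctor.map₂_id]
  exact Category.id_comp _

theorem comp_replacement_mapComp {A A' A'' : HypOF.{v, u}} (f : A ⟶ A') (g : A' ⟶ A'') :
    (forgetPseudo.comp (replacement K e)).mapComp f g =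
      InducedBicategory.isoMk (conjComp K e (forgetOF.map f) (forgetOF.map g)) := by
  refine Iso.ext ?_
  change (replacement K e).map₂ (𝟙 _) ≫ _ = _
  rw [PrelaxFunctor.map₂_id]
  exact Category.id_comp _

open scoped Pseudofunctor.StrongTrans

/-- Objectwise-free replacement followed by forgetting is equivalent to the identity. -/
def replacementForget :
    Bicategory.Equivalence ((replacement K e).comp forgetPseudo) (Pseudofunctor.id Hyp.{v, u}) :=
  let η : (replacement K e).comp forgetPseudo ⟶ Pseudofunctor.id Hyp.{v, u} :=
    { app H := (e H).hom
      naturality f := conjHom K e f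
      naturality_naturality a := conjHom_naturality K e a
      naturality_id H := by
        rw [replacement_comp_mapId]
        exact (comp_whiskerLeft_id _ _).trans (conjHom_id K e H)
      naturality_comp f g := by
        rw [replacement_comp_mapComp]
        exact (comp_whiskerLeft_id _ _).trans (conjHom_comp K e f g) }
  let θ : Pseudofunctor.id Hyp.{v, u} ⟶ (replacement K e).comp forgetPseudo :=
    { app H := (e H).inv
      naturality f := conjInv K e f
      naturality_naturality a := conjInv_naturality K e a
      naturality_id H := by
        rw [replacement_comp_mapId]
        refine Eq.trans ?_ (id_whiskerRight_comp _ _).symm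
        exact conjInv_id K e H
      naturality_comp f g := by
        rw [replacement_comp_mapComp]
        refine Eq.trans ?_ (id_whiskerRight_comp _ _).symm
        exact conjInv_comp K e f g }
  .mkOfAdjointifyCounit (f := η) (g := θ)
    (Pseudofunctor.StrongTrans.isoMk (fun H => (e H).unit)
      fun f => unit_modification K e f)
    (Pseudofunctor.StrongTrans.isoMk (fun H => (e H).counit)
      fun f => counit_modification K e f)

/-- Forgetting followed by objectwise-free replacement is equivalent to the identity. -/
def forgetReplacement :
    Bicategory.Equivalence (forgetPseudo.comp (replacement K e)) (Pseudofunctor.id HypOF.{v, u}) :=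
  let η : forgetPseudo.comp (replacement K e) ⟶ Pseudofunctor.id HypOF.{v, u} :=
    { app H := InducedBicategory.mkHom (e (forgetOF.obj H)).hom
      naturality f := InducedBicategory.isoMk (conjHom K e f.hom)
      naturality_naturality a := InducedBicategory.hom₂_ext (conjHom_naturality K e a.hom)
      naturality_id H := by
        rw [comp_replacement_mapId]
        exact (comp_whiskerLeft_id _ _).trans
          (InducedBicategory.hom₂_ext (conjHom_id K e (forgetOF.obj H)))
      naturality_comp f g := by
        rw [comp_replacement_mapComp]
        exact (comp_whiskerLeft_id _ _).trans
          (InducedBicategory.hom₂_ext (conjHom_comp K e f.hom g.hom)) }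
  let θ : Pseudofunctor.id HypOF.{v, u} ⟶ forgetPseudo.comp (replacement K e) :=
    { app H := InducedBicategory.mkHom (e (forgetOF.obj H)).inv
      naturality f := InducedBicategory.isoMk (conjInv K e f.hom)
      naturality_naturality a := InducedBicategory.hom₂_ext (conjInv_naturality K e a.hom)
      naturality_id H := by
        rw [comp_replacement_mapId]
        refine Eq.trans ?_ (id_whiskerRight_comp _ _).symm
        exact InducedBicategory.hom₂_ext (conjInv_id K e (forgetOF.obj H))
      naturality_comp f g := by
        rw [comp_replacement_mapComp]
        refine Eq.trans ?_ (id_whiskerRight_comp _ _).symm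
        exact InducedBicategory.hom₂_ext (conjInv_comp K e f.hom g.hom) }
  .mkOfAdjointifyCounit (f := η) (g := θ)
    (Pseudofunctor.StrongTrans.isoMk (fun H => InducedBicategory.isoMk (e (forgetOF.obj H)).unit)
      fun f => InducedBicategory.hom₂_ext (unit_modification K e f.hom))
    (Pseudofunctor.StrongTrans.isoMk (fun H => InducedBicategory.isoMk (e (forgetOF.obj H)).counit)
      fun f => InducedBicategory.hom₂_ext (counit_modification K e f.hom))

theorem forgetOF_is2Equivalence (K : Hyp.{v, u} → HypOF.{v, u})
    (e : ∀ H, Bicategory.Equivalence (forgetOF.obj (K H)) H) :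
    Is2Equivalence (forgetOF : StrictPseudofunctor HypOF.{v, u} Hyp.{v, u}).toPseudofunctor :=
  ⟨replacement K e, ⟨forgetReplacement K e⟩, ⟨replacementForget K e⟩⟩

end Replacement

end PseudoInverse

/-! ### Frobenius homomorphisms and the coherence isomorphisms. -/

section FrobeniusHom

variable {C : Type u} [Category.{v} C] [MonoidalCategory C] [SymmetricCategory C]
  [HypergraphCategory C]

/-- The axiom on `η_I` already fixes `μ_I`, through the monoid unit law. -/
theorem mul_unit : (HypergraphCategory.frob (𝟙_ C)).mul = (λ_ (𝟙_ C)).hom := by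
  have h := (HypergraphCategory.frob (𝟙_ C)).one_mul
  rw [HypergraphCategory.one_unit] at h
  simpa using h

theorem comul_unit : (HypergraphCategory.frob (𝟙_ C)).comul = (λ_ (𝟙_ C)).inv := by
  have h := (HypergraphCategory.frob (𝟙_ C)).counit_comul
  rw [HypergraphCategory.counit_unit] at h
  simpa using h

/-- A morphism is a Frobenius homomorphism if it preserves the chosen Frobenius structures. -/
structure IsFrobeniusHom {X Y : C} (f : X ⟶ Y) : Prop where
  mul : (HypergraphCategory.frob X).mul ≫ f = (f ⊗ₘ f) ≫ (HypergraphCategory.frob Y).mul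
  one : (HypergraphCategory.frob X).one ≫ f = (HypergraphCategory.frob Y).one
  comul : f ≫ (HypergraphCategory.frob Y).comul = (HypergraphCategory.frob X).comul ≫ (f ⊗ₘ f)
  counit : f ≫ (HypergraphCategory.frob Y).counit = (HypergraphCategory.frob X).counit

namespace IsFrobeniusHom

protected theorem id (X : C) : IsFrobeniusHom (𝟙 X) where
  mul := by simp
  one := by simp
  comul := by simp
  counit := by simp

variable {X Y Z X' Y' : C}

theorem comp {f : X ⟶ Y} {g : Y ⟶ Z} (hf : IsFrobeniusHom f) (hg : IsFrobeniusHom g) :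
    IsFrobeniusHom (f ≫ g) where
  mul := by
    rw [← Category.assoc, hf.mul, Category.assoc, hg.mul, tensorHom_comp_tensorHom_assoc]
  one := by rw [← Category.assoc, hf.one, hg.one]
  comul := by
    rw [Category.assoc, hg.comul, ← Category.assoc, hf.comul, Category.assoc,
      tensorHom_comp_tensorHom]
  counit := by rw [Category.assoc, hg.counit, hf.counit]

theorem inv {e : X ≅ Y} (h : IsFrobeniusHom e.hom) : IsFrobeniusHom e.inv where
  mul := by
    rw [Iso.comp_inv_eq, Category.assoc, h.mul, tensorHom_comp_tensorHom_assoc]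
    simp
  one := by rw [Iso.comp_inv_eq, h.one]
  comul := by
    rw [Iso.inv_comp_eq, ← Category.assoc, h.comul, Category.assoc, tensorHom_comp_tensorHom]
    simp
  counit := by rw [Iso.inv_comp_eq, h.counit]

theorem tensor {f : X ⟶ Y} {g : X' ⟶ Y'} (hf : IsFrobeniusHom f) (hg : IsFrobeniusHom g) :
    IsFrobeniusHom (f ⊗ₘ g) where
  mul := by
    rw [HypergraphCategory.mul_tensor, HypergraphCategory.mul_tensor, tensorμ_natural_assoc,
      Category.assoc, tensorHom_comp_tensorHom, tensorHom_comp_tensorHom, hf.mul, hg.mul]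
  one := by
    rw [HypergraphCategory.one_tensor, HypergraphCategory.one_tensor,
      Category.assoc, tensorHom_comp_tensorHom, hf.one, hg.one]
  comul := by
    rw [HypergraphCategory.comul_tensor, HypergraphCategory.comul_tensor, Category.assoc,
      ← tensorμ_natural, tensorHom_comp_tensorHom_assoc, tensorHom_comp_tensorHom_assoc, hf.comul,
      hg.comul]
  counit := by
    rw [HypergraphCategory.counit_tensor, HypergraphCategory.counit_tensor,
      tensorHom_comp_tensorHom_assoc, hf.counit, hg.counit]

theorem whiskerLeft (W : C) {f : X ⟶ Y} (hf : IsFrobeniusHom f) : IsFrobeniusHom (W ◁ f) := by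
  simpa using (IsFrobeniusHom.id W).tensor hf

theorem whiskerRight (W : C) {f : X ⟶ Y} (hf : IsFrobeniusHom f) : IsFrobeniusHom (f ▷ W) := by
  simpa using hf.tensor (IsFrobeniusHom.id W)

variable (X Y Z)

theorem leftUnitor : IsFrobeniusHom (λ_ X).hom where
  mul := by
    rw [HypergraphCategory.mul_tensor, mul_unit]
    let _ := (HypergraphCategory.frob X).toMonObj
    exact MonObj.mul_leftUnitor
  one := by
    rw [HypergraphCategory.one_tensor, HypergraphCategory.one_unit]
    simp
  comul := by
    rw [HypergraphCategory.comul_tensor, comul_unit, Category.assoc, tensorHom_def',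
      Category.assoc, ← tensor_left_unitality, leftUnitor_naturality]
  counit := by
    rw [HypergraphCategory.counit_tensor, HypergraphCategory.counit_unit]
    simp

theorem rightUnitor : IsFrobeniusHom (ρ_ X).hom where
  mul := by
    rw [HypergraphCategory.mul_tensor, mul_unit]
    let _ := (HypergraphCategory.frob X).toMonObj
    exact MonObj.mul_rightUnitor
  one := by
    rw [HypergraphCategory.one_tensor, HypergraphCategory.one_unit]
    simp [← unitors_equal]
  comul := by
    rw [HypergraphCategory.comul_tensor, comul_unit, Category.assoc, MonoidalCategory.tensorHom_def,
      Category.assoc, ← tensor_right_unitality, rightUnitor_naturality]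
  counit := by
    rw [HypergraphCategory.counit_tensor, HypergraphCategory.counit_unit]
    simp [unitors_equal]

theorem associator : IsFrobeniusHom (α_ X Y Z).hom where
  mul := by
    simp only [HypergraphCategory.mul_tensor]
    let _ := (HypergraphCategory.frob X).toMonObj
    let _ := (HypergraphCategory.frob Y).toMonObj
    let _ := (HypergraphCategory.frob Z).toMonObj
    exact MonObj.mul_associator
  one := by
    simp only [HypergraphCategory.one_tensor]
    let _ := (HypergraphCategory.frob X).toMonObj
    let _ := (HypergraphCategory.frob Y).toMonObj
    let _ := (HypergraphCategory.frob Z).toMonObj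
    exact MonObj.one_associator
  comul := by
    simp only [HypergraphCategory.comul_tensor, Category.assoc]
    -- Inserting identities splits off the interchange maps, so that their associativity coherence
    -- applies.
    rw [← Category.comp_id (HypergraphCategory.frob Z).comul, ← tensorHom_comp_tensorHom,
      Category.assoc,
      tensorHom_id, tensor_associativity, associator_naturality_assoc,
      ← Category.comp_id (HypergraphCategory.frob X).comul,
      ← tensorHom_comp_tensorHom_assoc, id_tensorHom]
    simp
  counit := by
    simp only [HypergraphCategory.counit_tensor]
    calc
      _ = (α_ X Y Z).hom ≫ ((HypergraphCategory.frob X).counit ⊗ₘ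
          ((HypergraphCategory.frob Y).counit ⊗ₘ (HypergraphCategory.frob Z).counit)) ≫
          𝟙_ C ◁ (λ_ (𝟙_ C)).hom ≫ (λ_ (𝟙_ C)).hom := by
        rw [← id_tensorHom, tensorHom_comp_tensorHom_assoc, Category.comp_id]
      _ = (((HypergraphCategory.frob X).counit ⊗ₘ (HypergraphCategory.frob Y).counit) ⊗ₘ
          (HypergraphCategory.frob Z).counit) ≫
          (λ_ (𝟙_ C)).hom ▷ 𝟙_ C ≫ (λ_ (𝟙_ C)).hom := by
        rw [← associator_naturality_assoc, triangle_assoc, unitors_equal]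
      _ = _ := by
        rw [← tensorHom_id, tensorHom_comp_tensorHom_assoc, Category.comp_id]

end IsFrobeniusHom

end FrobeniusHom

/-! ### Pulling back hypergraph structures along fully faithful functors. -/

section Pullback

open Functor.LaxMonoidal Functor.OplaxMonoidal Functor.Monoidal

variable {C D : Type u} [Category.{v} C] [MonoidalCategory C] [SymmetricCategory C]
  [Category.{v} D] [MonoidalCategory D] [SymmetricCategory D]

/-- Frobenius structures can be pulled back along fully faithful strong symmetric monoidal
functors. -/
def FrobeniusStructure.pullback {F : D ⥤ C} [F.Braided] (hF : F.FullyFaithful) {X : D}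
    (S : FrobeniusStructure (F.obj X)) : FrobeniusStructure X where
  toMonObj :=
    let _ := S.toMonObj
    hF.monObj X
  comul := hF.preimage (S.comul ≫ μ F X X)
  counit := hF.preimage (S.counit ≫ ε F)
  counit_comul := hF.map_injective (by
    have h := S.counit_comul
    simp [← μ_natural_left]
    )
  comul_counit := hF.map_injective (by
    have h := S.comul_counit
    simp [← μ_natural_right]
    )
  comul_assoc := hF.map_injective (by
    have h := S.comul_assoc
    simp only [Functor.map_comp, map_whiskerRight, map_whiskerLeft, map_associator, hF.map_preimage,
      comp_whiskerRight, whiskerLeft_comp, Category.assoc, μ_δ_assoc, whiskerRight_μ_δ_assoc,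
      reassoc_of% h])
  mul_comm := hF.map_injective (by
    simp [S.mul_comm])
  comul_comm := hF.map_injective (by
    have h := S.comul_comm
    simp [reassoc_of% h])
  frobenius_left := hF.map_injective (by
    have h := S.frobenius_left
    simp only [Functor.map_comp, map_whiskerRight, map_whiskerLeft, map_associator, hF.map_preimage,
      Functor.FullyFaithful.monObj_mul,
      comp_whiskerRight, whiskerLeft_comp, Category.assoc, μ_δ_assoc, whiskerRight_μ_δ_assoc,
      whiskerLeft_μ_δ_assoc, reassoc_of% h])
  frobenius_right := hF.map_injective (by
    have h := S.frobenius_right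
    simp only [Functor.map_comp, map_whiskerRight, map_whiskerLeft, map_associator_inv,
      hF.map_preimage, Functor.FullyFaithful.monObj_mul,
      comp_whiskerRight, whiskerLeft_comp, Category.assoc, μ_δ_assoc, whiskerRight_μ_δ_assoc,
      whiskerLeft_μ_δ_assoc, reassoc_of% h])
  special := hF.map_injective (by
    simp [S.special])

section

variable {F : D ⥤ C} [F.Braided] (hF : F.FullyFaithful) {X : D} (S : FrobeniusStructure (F.obj X))

@[simp]
theorem FrobeniusStructure.map_pullback_mul : F.map (S.pullback hF).mul = δ F X X ≫ S.mul :=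
  hF.map_preimage _

@[simp]
theorem FrobeniusStructure.map_pullback_one : F.map (S.pullback hF).one = η F ≫ S.one :=
  hF.map_preimage _

@[simp]
theorem FrobeniusStructure.map_pullback_comul : F.map (S.pullback hF).comul = S.comul ≫ μ F X X :=
  hF.map_preimage _

@[simp]
theorem FrobeniusStructure.map_pullback_counit : F.map (S.pullback hF).counit = S.counit ≫ ε F :=
  hF.map_preimage _

end

variable [HypergraphCategory C]

/-- The hypergraph structure pulled back along a fully faithful strong symmetric monoidal functor
whose coherence maps are Frobenius homomorphisms. -/
@[reducible]
def HypergraphCategory.pullback {F : D ⥤ C} [F.Braided] (hF : F.FullyFaithful)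
    (hμ : ∀ X Y, IsFrobeniusHom (μ F X Y)) (hε : IsFrobeniusHom (ε F)) :
    HypergraphCategory D where
  frob X := (HypergraphCategory.frob (F.obj X)).pullback hF
  mul_tensor X Y := hF.map_injective (by
    have h := (hμ X Y).mul
    rw [HypergraphCategory.mul_tensor] at h
    rw [← cancel_epi (μ F (X ⊗ Y) (X ⊗ Y)), ← cancel_epi (μ F X Y ⊗ₘ μ F X Y)]
    simp only [FrobeniusStructure.map_pullback_mul, μ_δ_assoc, Functor.map_comp, map_tensor,
      ← tensorμ_comp_μ_tensorHom_μ_comp_μ_assoc, tensorHom_comp_tensorHom_assoc]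
    rw [← h, Category.assoc])
  one_tensor X Y := hF.map_injective (by
    have h := (hμ X Y).one
    rw [HypergraphCategory.one_tensor] at h
    simp only [FrobeniusStructure.map_pullback_one, Functor.map_comp, map_tensor]
    -- Oplax unitality of `F` at the unit object, with `ε` and `η` cancelled.
    have hε' : (λ_ (𝟙_ C)).inv =
        ε F ≫ F.map (λ_ (𝟙_ D)).inv ≫ δ F (𝟙_ D) (𝟙_ D) ≫ (η F ⊗ₘ η F) := by
      rw [MonoidalCategory.tensorHom_def, ← Functor.OplaxMonoidal.left_unitality_assoc,
        leftUnitor_inv_naturality_assoc, ← whiskerLeft_comp, ε_η]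
      simp
    rw [← h, ← cancel_epi (ε F), ← tensorHom_comp_tensorHom, hε']
    simp)
  comul_tensor X Y := hF.map_injective (by
    have h := (hμ X Y).comul
    rw [HypergraphCategory.comul_tensor] at h
    rw [← cancel_epi (μ F X Y)]
    simp only [FrobeniusStructure.map_pullback_comul,
      μ_δ_assoc, Functor.map_comp, map_tensor, reassoc_of% h, ← tensorHom_comp_tensorHom,
      tensorμ_comp_μ_tensorHom_μ_comp_μ, Category.assoc])
  counit_tensor X Y := hF.map_injective (by
    have h := (hμ X Y).counit
    rw [HypergraphCategory.counit_tensor] at h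
    rw [← cancel_epi (μ F X Y)]
    simp only [FrobeniusStructure.map_pullback_counit,
      Functor.map_comp, map_tensor, reassoc_of% h, μ_δ_assoc, Category.assoc]
    rw [← tensorHom_comp_tensorHom_assoc, tensorHom_def' (ε F), Category.assoc,
      ← Functor.LaxMonoidal.left_unitality,
      leftUnitor_naturality])
  one_unit := hF.map_injective (by
    have h := hε.one
    rw [HypergraphCategory.one_unit, Category.id_comp] at h
    rw [FrobeniusStructure.map_pullback_one, ← h, η_ε, CategoryTheory.Functor.map_id])
  counit_unit := hF.map_injective (by
    have h := hε.counit
    rw [HypergraphCategory.counit_unit] at h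
    rw [← cancel_epi (ε F), FrobeniusStructure.map_pullback_counit, reassoc_of% h]
    simp)

theorem preservesFrobenius_pullback {F : D ⥤ C} [F.Braided] (hF : F.FullyFaithful)
    (hμ : ∀ X Y, IsFrobeniusHom (μ F X Y)) (hε : IsFrobeniusHom (ε F)) :
    letI := HypergraphCategory.pullback hF hμ hε
    PreservesFrobenius F :=
  letI := HypergraphCategory.pullback hF hμ hε
  { mul X := by
      change _ = _ ≫ F.map (hF.preimage _)
      simp
    one X := by
      change _ = _ ≫ F.map (hF.preimage _)
      simp
    comul X := by
      change _ = F.map (hF.preimage _) ≫ _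
      simp
    counit X := by
      change _ = F.map (hF.preimage _) ≫ _
      simp }

end Pullback

/-! ### Transfer of Frobenius preservation. -/

section Preserves

open Functor.LaxMonoidal Functor.OplaxMonoidal Functor.Monoidal

variable {C D : Type u} [Category.{v} C] [MonoidalCategory C] [SymmetricCategory C]
  [HypergraphCategory C] [Category.{v} D] [MonoidalCategory D] [SymmetricCategory D]
  [HypergraphCategory D]

theorem PreservesFrobenius.ofNatIso {F G : C ⥤ D} [F.Braided] [G.Braided] [PreservesFrobenius F]
    (i : F ≅ G) [NatTrans.IsMonoidal i.hom] (hi : ∀ X, IsFrobeniusHom (i.hom.app X)) :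
    PreservesFrobenius G where
  mul X := by
    rw [← cancel_epi (i.hom.app X ⊗ₘ i.hom.app X), ← (hi X).mul, PreservesFrobenius.mul (F := F),
      ← NatTrans.IsMonoidal.tensor_assoc, Category.assoc, i.hom.naturality]
  one X := by
    rw [← (hi X).one, PreservesFrobenius.one (F := F), Category.assoc, i.hom.naturality,
      ← NatTrans.IsMonoidal.unit (τ := i.hom), Category.assoc]
  comul X := by
    have h := NatTrans.IsMonoidal.tensor (τ := i.hom) X X
    -- Monoidality of `i` concerns `μ`; inverting `μ` gives its form for `δ`.
    have hδ : i.hom.app (X ⊗ X) ≫ δ G X X = δ F X X ≫ (i.hom.app X ⊗ₘ i.hom.app X) := by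
      rw [← cancel_epi (μ F X X), reassoc_of% h, μ_δ, Category.comp_id, μ_δ_assoc]
    rw [← cancel_epi (i.hom.app X), (hi X).comul, PreservesFrobenius.comul (F := F),
      ← i.hom.naturality_assoc, Category.assoc, hδ]
  counit X := by
    have h := NatTrans.IsMonoidal.unit (τ := i.hom)
    have hη : i.hom.app (𝟙_ C) ≫ η G = η F := by
      rw [← cancel_epi (ε F), reassoc_of% h, ε_η, ε_η]
    rw [← cancel_epi (i.hom.app X), (hi X).counit, PreservesFrobenius.counit (F := F),
      ← i.hom.naturality_assoc, hη]

/-- The faithful `G` reflects each equation. It serves for the inverse of an equivalence, whose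
composite with the equivalence is isomorphic to the identity. -/
theorem PreservesFrobenius.of_comp {E : Type u} [Category.{v} E] [MonoidalCategory E]
    [SymmetricCategory E] [HypergraphCategory E] (F : C ⥤ D) (G : D ⥤ E) [F.Braided] [G.Braided]
    [G.Faithful] [PreservesFrobenius G] [PreservesFrobenius (F ⋙ G)] : PreservesFrobenius F where
  mul X := G.map_injective (by
    have h := PreservesFrobenius.mul (F := F ⋙ G) X
    have h' := PreservesFrobenius.mul (F := G) (F.obj X)
    rw [← cancel_epi (μ G (F.obj X) (F.obj X)), ← h']
    simpa using h)
  one X := G.map_injective (by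
    have h := PreservesFrobenius.one (F := F ⋙ G) X
    have h' := PreservesFrobenius.one (F := G) (F.obj X)
    rw [← cancel_epi (ε G), ← h']
    simpa using h)
  comul X := G.map_injective (by
    have h := PreservesFrobenius.comul (F := F ⋙ G) X
    have h' := PreservesFrobenius.comul (F := G) (F.obj X)
    rw [← cancel_mono (δ G (F.obj X) (F.obj X)), ← h']
    simpa using h)
  counit X := G.map_injective (by
    have h := PreservesFrobenius.counit (F := F ⋙ G) X
    have h' := PreservesFrobenius.counit (F := G) (F.obj X)
    rw [← cancel_mono (η G), ← h']
    simpa using h)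

end Preserves

/-! ### Products of lists of objects. -/

section Realization

variable {C : Type u} [Category.{v} C] [MonoidalCategory C]

/-- The right-nested product of a list of objects. -/
@[reducible]
def realize : List C → C
  | [] => 𝟙_ C
  | x :: xs => x ⊗ realize xs

/-- Realization turns concatenation into the monoidal product, up to coherent isomorphism. -/
def realizeAppend : ∀ x y : List C, realize x ⊗ realize y ≅ realize (x ++ y)
  | [], y => λ_ (realize y)
  | x :: xs, y => α_ x (realize xs) (realize y) ≪≫ whiskerLeftIso x (realizeAppend xs y)

/-- Induction on the first list, along which `realizeAppend` recurses: unitor coherence for `[]`,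
the pentagon for a cons. -/
theorem realizeAppend_assoc : ∀ x y z : List C,
    (realizeAppend x y).hom ▷ realize z ≫ (realizeAppend (x ++ y) z).hom ≫
        eqToHom (congrArg realize (List.append_assoc x y z)) =
      (α_ (realize x) (realize y) (realize z)).hom ≫ realize x ◁ (realizeAppend y z).hom ≫
        (realizeAppend x (y ++ z)).hom
  | [], y, z => by
    change (λ_ (realize y)).hom ▷ realize z ≫ (realizeAppend y z).hom ≫ 𝟙 _ =
      (α_ (𝟙_ C) (realize y) (realize z)).hom ≫ 𝟙_ C ◁ (realizeAppend y z).hom ≫ (λ_ _).hom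
    simp
  | x :: xs, y, z => by
    have ih := congrArg (x ◁ ·) (realizeAppend_assoc xs y z)
    change ((α_ x (realize xs) (realize y)).hom ≫ x ◁ (realizeAppend xs y).hom) ▷ realize z ≫
        ((α_ x (realize (xs ++ y)) (realize z)).hom ≫ x ◁ (realizeAppend (xs ++ y) z).hom) ≫
          eqToHom (congrArg (x ⊗ ·) (congrArg realize (List.append_assoc xs y z))) =
      (α_ (x ⊗ realize xs) (realize y) (realize z)).hom ≫
        (x ⊗ realize xs) ◁ (realizeAppend y z).hom ≫
          (α_ x (realize xs) (realize (y ++ z))).hom ≫ x ◁ (realizeAppend xs (y ++ z)).hom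
    simp only [whiskerLeft_comp, whiskerLeft_eqToHom] at ih
    simp [ih]

theorem realizeAppend_nil : ∀ x : List C,
    (realizeAppend x []).hom ≫ eqToHom (congrArg realize (List.append_nil x)) =
      (ρ_ (realize x)).hom
  | [] => by
    change (λ_ (𝟙_ C)).hom ≫ 𝟙 _ = (ρ_ (𝟙_ C)).hom
    simp [unitors_equal]
  | x :: xs => by
    have ih := congrArg (x ◁ ·) (realizeAppend_nil xs)
    change ((α_ x (realize xs) (𝟙_ C)).hom ≫ x ◁ (realizeAppend xs []).hom) ≫
      eqToHom (congrArg (x ⊗ ·) (congrArg realize (List.append_nil xs))) =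
        (ρ_ (x ⊗ realize xs)).hom
    simp only [whiskerLeft_comp, whiskerLeft_eqToHom] at ih
    simp [ih]

theorem eqToHom_realize_append_assoc (x y z : List C) :
    eqToHom (congrArg realize (List.append_assoc x y z)) =
      ((realizeAppend (x ++ y) z).inv ≫ ((realizeAppend x y).inv ⊗ₘ 𝟙 (realize z))) ≫
        (α_ (realize x) (realize y) (realize z)).hom ≫
          (𝟙 (realize x) ⊗ₘ (realizeAppend y z).hom) ≫ (realizeAppend x (y ++ z)).hom := by
  rw [id_tensorHom, ← realizeAppend_assoc]
  simp

theorem eqToHom_realize_append_nil (x : List C) :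
    eqToHom (congrArg realize (List.append_nil x)) =
      ((realizeAppend x []).inv ≫ (𝟙 (realize x) ⊗ₘ 𝟙 (𝟙_ C))) ≫ (ρ_ (realize x)).hom := by
  rw [← realizeAppend_nil]
  simp

/-- The pre-parenthesized product with a trailing unit is isomorphic to the right-nested one. -/
def foldlIso (a : C) : ∀ xs : List C, xs.foldl (fun a b => a ⊗ b) a ⊗ 𝟙_ C ≅ a ⊗ realize xs
  | [] => Iso.refl _
  | x :: xs => foldlIso (a ⊗ x) xs ≪≫ α_ a x (realize xs)

/-- The two products of a list of objects are isomorphic. -/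
def realizeIso : ∀ x : List C, realize x ≅ listTensor x
  | [] => Iso.refl _
  | x :: xs => (foldlIso x xs).symm

variable [SymmetricCategory C] [HypergraphCategory C]

theorem isFrobeniusHom_realizeAppend : ∀ x y : List C, IsFrobeniusHom (realizeAppend x y).hom
  | [], _ => IsFrobeniusHom.leftUnitor _
  | x :: xs, y => (IsFrobeniusHom.associator _ _ _).comp
      ((isFrobeniusHom_realizeAppend xs y).whiskerLeft x)

theorem isFrobeniusHom_foldlIso (a : C) : ∀ xs : List C, IsFrobeniusHom (foldlIso a xs).hom
  | [] => IsFrobeniusHom.id _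
  | x :: xs => (isFrobeniusHom_foldlIso (a ⊗ x) xs).comp (IsFrobeniusHom.associator _ _ _)

theorem isFrobeniusHom_realizeIso : ∀ x : List C, IsFrobeniusHom (realizeIso x).hom
  | [] => IsFrobeniusHom.id _
  | x :: xs => (isFrobeniusHom_foldlIso x xs).inv

end Realization

/-! ### The strictification and its hypergraph structure. -/

section Strictification

variable (C : Type u) [Category.{v} C] [MonoidalCategory C]

/-- The strictification of a monoidal category: lists of objects, with the morphisms between the
realizations. -/
abbrev Strictification : Type u := InducedCategory C (realize : List C → C)

namespace Strictification

/-- Realization, as a functor on the strictification. -/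
abbrev real : Strictification C ⥤ C := inducedFunctor realize

variable {C}

/-- Associators and unitors are list equalities, so strictness is immediate; the monoidal axioms are
later reflected along `real`. -/
instance monoidalStruct : MonoidalCategoryStruct (Strictification C) where
  tensorObj x y := List.append x y
  whiskerLeft x _ _ f := InducedCategory.homMk
    ((realizeAppend _ _).inv ≫ realize x ◁ f.hom ≫ (realizeAppend _ _).hom)
  whiskerRight f y := InducedCategory.homMk
    ((realizeAppend _ _).inv ≫ f.hom ▷ realize y ≫ (realizeAppend _ _).hom)
  tensorHom f g := InducedCategory.homMk
    ((realizeAppend _ _).inv ≫ (f.hom ⊗ₘ g.hom) ≫ (realizeAppend _ _).hom)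
  tensorUnit := ([] : List C)
  associator x y z := eqToIso (List.append_assoc x y z)
  leftUnitor _ := Iso.refl _
  rightUnitor x := eqToIso (List.append_nil x)

/-- Realization transports the operations on lists to the monoidal structure. -/
def inducingData : Monoidal.InducingFunctorData (real C) where
  μIso x y := realizeAppend x y
  εIso := Iso.refl _
  whiskerLeft_eq _ _ _ _ := rfl
  whiskerRight_eq _ _ := rfl
  tensorHom_eq _ _ := rfl
  associator_eq x y z := (eqToHom_map (real C) (List.append_assoc x y z)).trans
    (eqToHom_realize_append_assoc (C := C) x y z)
  leftUnitor_eq x := by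
    change 𝟙 (realize x) = ((λ_ (realize x)).inv ≫ (𝟙 (𝟙_ C) ⊗ₘ 𝟙 (realize x))) ≫
      (λ_ (realize x)).hom
    simp
  rightUnitor_eq x := (eqToHom_map (real C) (List.append_nil x)).trans
    (eqToHom_realize_append_nil (C := C) x)

instance monoidal : MonoidalCategory (Strictification C) :=
  Monoidal.induced (real C) inducingData

instance realMonoidal : (real C).Monoidal :=
  (Monoidal.fromInducedCoreMonoidal (real C) inducingData).toMonoidal

theorem isStrictMonoidal : IsStrictMonoidal (Strictification C) where
  tensor_assoc := List.append_assoc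
  unit_tensor _ := rfl
  tensor_unit := List.append_nil
  associator_hom _ _ _ := rfl
  leftUnitor_hom _ := rfl
  rightUnitor_hom _ := rfl

variable (C) in
/-- The strictification is objectwise free on the objects of the original category. -/
def objectwiseFree : ObjectwiseFree C (Strictification C) where
  strict := isStrictMonoidal
  equiv := Equiv.refl _
  equiv_nil := rfl
  equiv_append _ _ := rfl

variable [SymmetricCategory C]

instance braided : BraidedCategory (Strictification C) :=
  .ofFaithful (real C)
    (fun x y => InducedCategory.isoMk
      ((realizeAppend x y).symm ≪≫ β_ (realize x) (realize y) ≪≫ realizeAppend y x))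
    (fun x y => by
      change (realizeAppend x y).hom ≫ (realizeAppend x y).inv ≫ (β_ (realize x) (realize y)).hom ≫
        (realizeAppend y x).hom = _ ≫ (realizeAppend y x).hom
      simp)

instance realBraided : (real C).Braided where
  braided x y := by
    change (realizeAppend x y).hom ≫ (realizeAppend x y).inv ≫ (β_ (realize x) (realize y)).hom ≫
        (realizeAppend y x).hom = _ ≫ (realizeAppend y x).hom
    simp

instance symmetric : SymmetricCategory (Strictification C) := .ofFaithful (real C)

variable [HypergraphCategory C]

instance hypergraph : HypergraphCategory (Strictification C) :=
  .pullback (F := real C) (fullyFaithfulInducedFunctor _) isFrobeniusHom_realizeAppend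
    (IsFrobeniusHom.id _)

instance real_preservesFrobenius : PreservesFrobenius (real C) :=
  preservesFrobenius_pullback (F := real C) (fullyFaithfulInducedFunctor _)
    isFrobeniusHom_realizeAppend (IsFrobeniusHom.id _)

end Strictification

end Strictification

theorem inverseMonoidal_isMonoidal {C D : Type u} [Category.{v} C]
    [MonoidalCategory C] [Category.{v} D] [MonoidalCategory D] (e : C ≌ D) [e.functor.Monoidal] :
    letI := e.inverseMonoidal
    e.IsMonoidal := by
  let := e.toAdjunction.rightAdjointLaxMonoidal
  exact (inferInstance : e.toAdjunction.IsMonoidal)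

/-! ### Inverses of symmetric monoidal and hypergraph equivalences. -/

section InverseBraided

open Functor.LaxMonoidal

variable {C D : Type u} [Category.{v} C] [MonoidalCategory C] [SymmetricCategory C]
  [Category.{v} D] [MonoidalCategory D] [SymmetricCategory D]

/-- A natural isomorphism transports strong symmetric monoidal structures. -/
@[reducible]
def braidedTransport {F G : C ⥤ D} [F.Braided] (i : F ≅ G) : G.Braided :=
  letI := Functor.Monoidal.transport i
  haveI := Functor.Monoidal.natTransIsMonoidal_of_transport i
  { braided := (Functor.LaxBraided.ofNatIso i).braided }

/-- A strong monoidal functor is symmetric if its composition with a faithful strong symmetric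
monoidal functor is. -/
@[reducible]
def braidedOfComp (F : C ⥤ D) {E : Type u} [Category.{v} E] [MonoidalCategory E]
    [SymmetricCategory E] (G : D ⥤ E) [F.Monoidal] [G.Braided] [G.Faithful]
    (h : ∀ X Y, μ (F ⋙ G) X Y ≫ (F ⋙ G).map (β_ X Y).hom =
      (β_ ((F ⋙ G).obj X) ((F ⋙ G).obj Y)).hom ≫ μ (F ⋙ G) Y X) : F.Braided where
  braided X Y := G.map_injective (by
    have h := h X Y
    rw [← cancel_epi (μ G _ _)]
    simpa using h)

/-- The inverse of a strong symmetric monoidal equivalence is strong symmetric monoidal. -/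
@[reducible]
noncomputable def inverseBraided (e : C ≌ D) [e.functor.Braided] : e.inverse.Braided :=
  letI := e.inverseMonoidal
  haveI := inverseMonoidal_isMonoidal e
  haveI : NatTrans.IsMonoidal e.counitIso.hom :=
    inferInstanceAs (NatTrans.IsMonoidal e.toAdjunction.counit)
  letI : NatTrans.IsMonoidal e.counitIso.symm.hom :=
    inferInstanceAs (NatTrans.IsMonoidal e.counitIso.inv)
  -- The composite is monoidally isomorphic to the identity via the counit, hence respects
  -- braidings.
  braidedOfComp e.inverse e.functor (Functor.LaxBraided.ofNatIso e.counitIso.symm).braided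

end InverseBraided

namespace Hyp

variable {H K : Hyp.{v, u}} (e : (H : Type u) ≌ K) [e.functor.Braided]
  [PreservesFrobenius e.functor]

/-- A hypergraph functor whose underlying functor is an equivalence, with a counit consisting of
Frobenius homomorphisms, is a hypergraph equivalence. -/
noncomputable def equivalenceMk (hε : ∀ X, IsFrobeniusHom (e.counitIso.hom.app X)) :
    Bicategory.Equivalence H K :=
  letI := inverseBraided e
  haveI : e.IsMonoidal := inverseMonoidal_isMonoidal e
  haveI hη : NatTrans.IsMonoidal e.unitIso.hom :=
    inferInstanceAs (NatTrans.IsMonoidal e.unit)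
  haveI hε' : NatTrans.IsMonoidal e.counitIso.hom :=
    inferInstanceAs (NatTrans.IsMonoidal e.counit)
  haveI : NatTrans.IsMonoidal e.counitIso.symm.hom :=
    inferInstanceAs (NatTrans.IsMonoidal e.counitIso.inv)
  haveI : PreservesFrobenius (𝟭 K) := preservesFrobenius_id K
  haveI : PreservesFrobenius (e.inverse ⋙ e.functor) :=
    .ofNatIso e.counitIso.symm fun X => (hε X).inv (e := e.counitIso.app X)
  haveI : PreservesFrobenius e.inverse := .of_comp e.inverse e.functor
  let P : H ⟶ K := Hom.mk e.functor
  let S : K ⟶ H := Hom.mk e.inverse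
  .mkOfAdjointifyCounit (f := P) (g := S)
    (isoMk (F := 𝟙 H) (G := P ≫ S) e.unitIso (hm := hη))
    (isoMk (F := S ≫ P) (G := 𝟙 K) e.counitIso (hm := hε'))

end Hyp

/-! ### The equivalence of a hypergraph category with its strictification. -/

namespace Strictification

section

variable (C : Type u) [Category.{v} C] [MonoidalCategory C]

/-- The functor sending a list of objects to its pre-parenthesized product. -/
def prod : Strictification C ⥤ C where
  obj x := listTensor (C := C) x
  map f := (realizeIso _).inv ≫ f.hom ≫ (realizeIso _).hom

/-- The two realizations of the strictification are isomorphic. -/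
def realIsoProd : real C ≅ prod C :=
  NatIso.ofComponents (fun x => realizeIso (C := C) x) (fun f => by simp [prod])

instance : (prod C).Full := .of_iso (realIsoProd C)

instance : (prod C).Faithful := .of_iso (realIsoProd C)

/-- The inclusion of a monoidal category in its strictification as one-element lists. -/
def single : C ⥤ Strictification C where
  obj X := ([X] : List C)
  map f := InducedCategory.homMk (f ▷ 𝟙_ C)

/-- The product of a one-element list is isomorphic to its element. -/
def singleProdIso : single C ⋙ prod C ≅ 𝟭 C :=
  NatIso.ofComponents (fun X => ρ_ X) (fun {X Y} f => by
    change (𝟙 (X ⊗ 𝟙_ C) ≫ f ▷ 𝟙_ C ≫ 𝟙 (Y ⊗ 𝟙_ C)) ≫ (ρ_ Y).hom = (ρ_ X).hom ≫ f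
    simp)

/-- A monoidal category is equivalent to its strictification. -/
noncomputable def equivalence : Strictification C ≌ C :=
  .mk (prod C) (single C)
    -- The unit is lifted through the fully faithful `prod C`; `Equivalence.mk` adjusts it but keeps
    -- the counit `ρ`, as needed for the Frobenius condition.
    (Functor.fullyFaithfulCancelRight (prod C)
      ((prod C).leftUnitor ≪≫ (prod C).rightUnitor.symm ≪≫
        Functor.isoWhiskerLeft (prod C) (singleProdIso C).symm ≪≫
          (Functor.associator _ _ _).symm))
    (singleProdIso C)

variable [SymmetricCategory C] [HypergraphCategory C]

instance prodBraided : (prod C).Braided := braidedTransport (realIsoProd C)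

instance prod_preservesFrobenius : PreservesFrobenius (prod C) :=
  haveI : NatTrans.IsMonoidal (realIsoProd C).hom :=
    Functor.Monoidal.natTransIsMonoidal_of_transport (realIsoProd C)
  PreservesFrobenius.ofNatIso (realIsoProd C) fun x => isFrobeniusHom_realizeIso (C := C) x

noncomputable instance : (equivalence C).functor.Braided := inferInstanceAs (prod C).Braided

instance : PreservesFrobenius (equivalence C).functor :=
  inferInstanceAs (PreservesFrobenius (prod C))

end

/-- The strictification of a hypergraph category, as an object of `Hyp`. -/
abbrev hyp (H : Hyp.{v, u}) : Hyp.{v, u} where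
  carrier := Strictification H

/-- A hypergraph category is hypergraph equivalent to its strictification. -/
noncomputable def hypEquivalence (H : Hyp.{v, u}) : Bicategory.Equivalence (hyp H) H :=
  Hyp.equivalenceMk (H := hyp H) (equivalence H) fun X => IsFrobeniusHom.rightUnitor X

end Strictification

end HypergraphCat

theorem mainTheorem3 :
    Is2Equivalence (forgetOF : StrictPseudofunctor HypOF.{v, u} Hyp.{v, u}).toPseudofunctor ∧
    (∀ H : Hyp.{v, u}, ∃ K : HypOF.{v, u},
      Nonempty (Bicategory.Equivalence (forgetOF.obj K) H)) ∧
    (∀ H : Hyp.{v, u}, ∃ (K : Hyp.{v, u}) (s : ObjectwiseFree H K)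
      (e : Bicategory.Equivalence (forgetOF.obj ⟨K, H, s⟩) H),
      (∀ x : List H, e.hom.functor.obj (s.equiv x) = listTensor x) ∧
      (∀ X : H, e.inv.functor.obj X = s.equiv [X])) :=
  ⟨forgetOF_is2Equivalence
      (fun H => ⟨Strictification.hyp H, H, Strictification.objectwiseFree H⟩)
      Strictification.hypEquivalence,
    fun H => ⟨⟨Strictification.hyp H, H, Strictification.objectwiseFree H⟩,
      ⟨Strictification.hypEquivalence H⟩⟩,
    -- Adjointification alters only a 2-cell, so both functors remain `prod` and `single`, and their
    -- object formulas hold by definition.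
    fun H => ⟨Strictification.hyp H, Strictification.objectwiseFree H,
      Strictification.hypEquivalence H, fun _ => rfl, fun _ => rfl⟩⟩
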